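/- Let $\mathrm{FIN}$ be the set of nonempty finite subsets of $\mathbb N$, and write $s<t$ for $\max s<\min t$. Let $\mathrm{FIN}^\infty$ be the set of infinite block sequences $A=(s_0<s_1<\cdots)$ in $\mathrm{FIN}$, and $\mathrm{FIN}^{<\infty}$ the set of finite block sequences (including $\emptyset$); $|a|$ is the length of $a$ and $r_n(A)$ the sequence of the first $n$ blocks of $A$. Sequences are identified with their sets of blocks. Let $[A]=FU(A)$ be the set of all unions of finitely many (at least one) blocks of $A$, and put - $A\le B$ iff every block of $A$ is in $[B]$; $A\le^* B$ iff all but finitely many blocks of $A$ are in $[B]$; for finite $a,b$, $a\le_{\rm fin}b$ iff every block of $a$ is a union of (at least one) blocks of $b$; - $\mathrm{FIN}^{<\infty}\restriction A=\{a\in \mathrm{FIN}^{<\infty}: a\subseteq[A]\}$, and for such $a$, $\operatorname{depth}_A(a)=\min\{n: a\le_{\rm fin} r_n(A)\}$; - $[a,A]=\{B\in\mathrm{FIN}^\infty: B\le A,\ a=r_n(B)\text{ for some }n\}$, $[n,A]=[r_n(A),A]$, and $r_m[a,B]=\{r_m(C):C\in[a,B]\}$; - $B/b$ is the sequence of those blocks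 of $B$ that lie after all blocks of $b$. A family $\mathcal H\subseteq\mathrm{FIN}^\infty$ is a *coideal* if (a) $A\in\mathcal H$ and $A\triangle B$ finite imply $B\in\mathcal H$; (b) $A\in\mathcal H$ and $A\le B$ imply $B\in\mathcal H$; (c) for all $A\in\mathcal H$ and $a\in\mathrm{FIN}^{<\infty}\restriction A$: $[a,B]\ne\emptyset$ for every $B\in[\operatorname{depth}_A(a),A]\cap\mathcal H$; and if $B\in\mathcal H$, $B\le A$ and $[a,B]\neq\emptyset$, then there is $A'\in[\operatorname{depth}_A(a),A]\cap\mathcal H$ with $\emptyset\ne[a,A']\subseteq[a,B]$; (d) for all $A\in\mathcal H$, $a\in\mathrm{FIN}^{<\infty}\restriction A$ and every set $\mathcal O$ of finite block sequences of length $|a|+1$ there is $B\in[\operatorname{depth}_A(a),A]\cap\mathcal H$ with $r_{|a|+1}[a,B]\subseteq\mathcal O$ or $r_{|a|+1}[a,B]\cap\mathcal O=\emptyset$. A coideal $\mathcal H$ is *selective* if, whenever $A\in\mathcal H$, $[a,A]\neq\emptyset$, and $A_0\ge A_1\ge\cdots$ are members of $\mathcal H$ with $A_n\le A$ and $[a,A_n]\ne\emptyset$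 for all $n$, there is $B\in\mathcal H\cap[a,A]$ that diagonalizes $(A_n)$ within $A$, i.e. $B/b\le A_{\operatorname{depth}_A(b)}$ for every $b\in\mathrm{FIN}^{<\infty}\restriction B$. A family $\mathcal H\subseteq \mathrm{FIN}^\infty$ is *Matet-adequate* if it satisfies (a) and (b), $(\mathcal H,\le^*)$ is $\sigma$-closed (for every sequence $A_0\ge^*A_1\ge^*\cdots$ in $\mathcal H$ there is $B\in\mathcal H$ with $B\le^*A_n$ for all $n$), and it has the Hindman property: if $A\in\mathcal H$ and $FU(A)$ is partitioned into two pieces, there is $B\in\mathcal H$ with $B\le A$ such that $FU(B)$ is contained in one piece. **Theorem.** Every Matet-adequate family is a selective coideal of $\mathrm{FIN}^\infty$, and conversely. That is, for every $\mathcal H\subseteq\mathrm{FIN}^\infty$, $\mathcal H$ is Matet-adequate if and only if $\mathcal H$ is a selective coideal. -/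

import Mathlib

namespace BlockSeq

/-- `FIN`: the nonempty finite sets of natural numbers. -/
abbrev FIN : Type := {s : Finset ℕ // s.Nonempty}

/-- `s < t` in the block order: `max s < min t`. -/
def Precedes (s t : FIN) : Prop := s.1.max' s.2 < t.1.min' t.2

/-- `FIN^∞`: infinite block sequences of elements of `FIN`. -/
@[ext]
structure FINInf where
  block : ℕ → FIN
  precedes_succ : ∀ i, Precedes (block i) (block (i + 1))

/-- `FIN^{<∞}`: finite block sequences of elements of `FIN` (the empty one included). -/
@[ext]
structure FINFin where
  list : List FIN
  pairwise : list.Pairwise Precedes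

theorem Precedes.trans {s t u : FIN} (h : Precedes s t) (h' : Precedes t u) : Precedes s u :=
  lt_trans (lt_of_lt_of_le h (t.1.min'_le _ (t.1.max'_mem t.2))) h'

theorem FINInf.precedes_of_lt (A : FINInf) {i j : ℕ} (h : i < j) :
    Precedes (A.block i) (A.block j) := by
  induction j, h using Nat.le_induction with
  | base => exact A.precedes_succ i
  | succ j _ ih => exact ih.trans (A.precedes_succ j)

/-- The set of blocks of an infinite block sequence. -/
def FINInf.blocks (A : FINInf) : Set FIN := Set.range A.block

/-- The set of blocks of a finite block sequence. -/
def FINFin.blocks (a : FINFin) : Set FIN := {s | s ∈ a.list}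

/-- The length `|a|`. -/
def FINFin.length (a : FINFin) : ℕ := a.list.length

/-- `FU(S)`: all unions of finitely many (at least one) members of `S`. For the set of blocks of
`A ∈ FIN^∞` this is the subsemigroup `[A]` generated by `A`. -/
def FU (S : Set FIN) : Set FIN :=
  {t | ∃ F : Finset FIN, F.Nonempty ∧ (∀ s ∈ F, s ∈ S) ∧ t.1 = F.biUnion Subtype.val}

/-- `A ≤ B`: `A` is a condensation of `B`. -/
instance : LE FINInf := ⟨fun A B => A.blocks ⊆ FU B.blocks⟩

/-- `A ≤* B`: all but finitely many blocks of `A` belong to `[B]`. -/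
def AlmostLE (A B : FINInf) : Prop := (A.blocks \ FU B.blocks).Finite

/-- The approximation `r_n(A)`: the first `n` blocks of `A`. -/
def approx (n : ℕ) (A : FINInf) : FINFin where
  list := (List.range n).map A.block
  pairwise := by
    rw [List.pairwise_map]
    exact List.pairwise_lt_range.imp fun h => A.precedes_of_lt h

/-- The neighbourhood `[a, A]`. -/
def nbhd (a : FINFin) (A : FINInf) : Set FINInf := {B | (∃ n, a = approx n B) ∧ B ≤ A}

/-- `FIN^{<∞} ↾ A`: finite block sequences all of whose blocks belong to `[A]`. -/
def finBelow (A : FINInf) : Set FINFin := {a | a.blocks ⊆ FU A.blocks}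

/-- `a ≤_fin b`: every block of `a` is a finite union of blocks of `b`. -/
def LEFin (a b : FINFin) : Prop := a.blocks ⊆ FU b.blocks

/-- `depth_A(a) = min {n : a ≤_fin r_n(A)}`, meaningful for `a ∈ FIN^{<∞} ↾ A`. -/
noncomputable def depth (A : FINInf) (a : FINFin) : ℕ := sInf {n | LEFin a (approx n A)}

/-- The blocks of `B / b`: those blocks of `B` that lie entirely after `b`. -/
def blocksAfter (B : FINInf) (b : FINFin) : Set FIN :=
  {s | s ∈ B.blocks ∧ ∀ t ∈ b.blocks, Precedes t s}

/-- `H` is closed under finite changes. -/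
def ClosedUnderFiniteChanges (H : Set FINInf) : Prop :=
  ∀ A B : FINInf, A ∈ H → (symmDiff A.blocks B.blocks).Finite → B ∈ H

/-- `H` is closed upwards with respect to condensation. -/
def ClosedUpwards (H : Set FINInf) : Prop :=
  ∀ A B : FINInf, A ∈ H → A ≤ B → B ∈ H

/-- Coideals of `FIN^∞`. -/
structure IsCoideal (H : Set FINInf) : Prop where
  finite_changes : ClosedUnderFiniteChanges H
  upwards : ClosedUpwards H
  /-- A3 mod `H`, first part. -/
  amalgamation_nonempty : ∀ A ∈ H, ∀ a ∈ finBelow A,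
    ∀ B ∈ nbhd (approx (depth A a) A) A ∩ H, (nbhd a B).Nonempty
  /-- A3 mod `H`, second part. -/
  amalgamation_subset : ∀ A ∈ H, ∀ a ∈ finBelow A,
    ∀ B ∈ H, B ≤ A → (nbhd a B).Nonempty →
      ∃ A' ∈ nbhd (approx (depth A a) A) A ∩ H, (nbhd a A').Nonempty ∧ nbhd a A' ⊆ nbhd a B
  /-- A4 mod `H`. -/
  pigeonhole : ∀ A ∈ H, ∀ a ∈ finBelow A,
    ∀ O : Set FINFin, (∀ o ∈ O, o.length = a.length + 1) →
      ∃ B ∈ nbhd (approx (depth A a) A) A ∩ H,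
        approx (a.length + 1) '' nbhd a B ⊆ O ∨ approx (a.length + 1) '' nbhd a B ∩ O = ∅

/-- `B` diagonalizes the sequence `𝒜` within `A`: for every `b ∈ FIN^{<∞} ↾ B` with
`depth_A(b) = n`, one has `B / b ≤ 𝒜 n`. Equivalently, for every `C ∈ [b, B]` the part of `C`
after `b` is a condensation of `𝒜 n`. -/
def Diagonalizes (B : FINInf) (𝒜 : ℕ → FINInf) (A : FINInf) : Prop :=
  ∀ b ∈ finBelow B, b ∈ finBelow A → blocksAfter B b ⊆ FU (𝒜 (depth A b)).blocks

/-- Selective coideals of `FIN^∞`. -/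
structure IsSelectiveCoideal (H : Set FINInf) : Prop extends IsCoideal H where
  selective : ∀ (a : FINFin) (A : FINInf), A ∈ H → (nbhd a A).Nonempty →
    ∀ 𝒜 : ℕ → FINInf, (∀ n, 𝒜 n ∈ H ∧ 𝒜 n ≤ A) → (∀ n, 𝒜 (n + 1) ≤ 𝒜 n) →
      (∀ n, (nbhd a (𝒜 n)).Nonempty) →
        ∃ B ∈ H ∩ nbhd a A, Diagonalizes B 𝒜 A

/-- Matet-adequate families. -/
structure IsMatetAdequate (H : Set FINInf) : Prop where
  finite_changes : ClosedUnderFiniteChanges H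
  upwards : ClosedUpwards H
  /-- `(H, ≤*)` is σ-closed. -/
  sigma_closed : ∀ 𝒜 : ℕ → FINInf, (∀ n, 𝒜 n ∈ H) → (∀ n, AlmostLE (𝒜 (n + 1)) (𝒜 n)) →
    ∃ B ∈ H, ∀ n, AlmostLE B (𝒜 n)
  /-- The Hindman property. -/
  hindman : ∀ A ∈ H, ∀ P Q : Set FIN, P ∪ Q = FU A.blocks → Disjoint P Q →
    ∃ B ∈ H, B ≤ A ∧ (FU B.blocks ⊆ P ∨ FU B.blocks ⊆ Q)

end BlockSeq

namespace BlockSeq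

/-! ### Finite unions and block sequences -/

/-! Coideal to Matet-adequate: the pigeonhole axiom at the empty sequence is the Hindman property.
For σ-closure, cut initial blocks so that a `≤*`-decreasing sequence becomes `≤`-decreasing, then
diagonalize; past a block of depth at least `n`, a diagonalization lies in the `n`-th term
(`Diagonalizes.almostLE`).

Matet-adequate to coideal: with `d = depth_A(a)`, put `r_d(A)` in front of a suitable `B`. By
minimality of `d`, whatever comes after `a` uses no block of `r_d(A)` (`mem_FU_of_after_depth`), so
both amalgamation and pigeonhole reduce to finite changes and the Hindman property.

Selectivity is the main point. A lower bound `C` from σ-closure lies in the `n`-th term only past a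
bound `f n`, so its blocks must be spread out faster than `f`. The Hindman property does this: color
a set by the parity of its number of short gaps. On a monochromatic `FU(B)` no gap between blocks of
`B` is short (`lt_of_shortGaps_parity`). -/

theorem precedes_iff {s t : FIN} : Precedes s t ↔ ∀ x ∈ s.1, ∀ y ∈ t.1, x < y := by
  constructor
  · intro h x hx y hy
    exact lt_of_le_of_lt (s.1.le_max' x hx) (lt_of_lt_of_le h (t.1.min'_le y hy))
  · intro h
    exact h _ (s.1.max'_mem s.2) _ (t.1.min'_mem t.2)

/-- Choosing one member of `S` per point of the finite set `t` gives the finite family. This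
pointwise form replaces explicit unions in the later arguments. -/
theorem mem_FU {S : Set FIN} {t : FIN} :
    t ∈ FU S ↔ ∀ x ∈ t.1, ∃ s ∈ S, x ∈ s.1 ∧ s.1 ⊆ t.1 := by
  constructor
  · rintro ⟨F, -, hFS, ht⟩ x hx
    rw [ht, Finset.mem_biUnion] at hx
    obtain ⟨s, hs, hxs⟩ := hx
    exact ⟨s, hFS s hs, hxs, ht ▸ Finset.subset_biUnion_of_mem Subtype.val hs⟩
  · intro h
    choose f hfS hxf hft using h
    refine ⟨t.1.attach.image fun x => f x.1 x.2, ?_, ?_, ?_⟩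
    · exact (Finset.attach_nonempty_iff.2 t.2).image _
    · intro s hs
      obtain ⟨x, -, rfl⟩ := Finset.mem_image.1 hs
      exact hfS _ _
    · ext x
      simp only [Finset.mem_biUnion, Finset.mem_image, Finset.mem_attach, true_and]
      constructor
      · intro hx
        exact ⟨_, ⟨⟨x, hx⟩, rfl⟩, hxf x hx⟩
      · rintro ⟨_, ⟨y, rfl⟩, hx⟩
        exact hft _ _ hx

theorem subset_FU (S : Set FIN) : S ⊆ FU S := fun s hs =>
  mem_FU.2 fun _ hx => ⟨s, hs, hx, subset_rfl⟩

theorem FU_subset_FU {S T : Set FIN} (h : S ⊆ FU T) : FU S ⊆ FU T := by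
  intro t ht
  rw [mem_FU] at ht ⊢
  intro x hx
  obtain ⟨s, hs, hxs, hst⟩ := ht x hx
  obtain ⟨u, hu, hxu, hus⟩ := mem_FU.1 (h hs) x hxs
  exact ⟨u, hu, hxu, hus.trans hst⟩

theorem union_mem_FU {S : Set FIN} {s t u : FIN} (hs : s ∈ FU S) (ht : t ∈ FU S)
    (hu : u.1 = s.1 ∪ t.1) : u ∈ FU S := by
  rw [mem_FU] at *
  intro x hx
  rw [hu] at hx ⊢
  rcases Finset.mem_union.1 hx with h | h
  · obtain ⟨v, hv, hxv, hvs⟩ := hs x h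
    exact ⟨v, hv, hxv, hvs.trans Finset.subset_union_left⟩
  · obtain ⟨v, hv, hxv, hvs⟩ := ht x h
    exact ⟨v, hv, hxv, hvs.trans Finset.subset_union_right⟩

theorem FINInf.le_iff {A B : FINInf} : A ≤ B ↔ A.blocks ⊆ FU B.blocks := Iff.rfl

theorem FINInf.le_trans {A B C : FINInf} (h : A ≤ B) (h' : B ≤ C) : A ≤ C :=
  fun _ hs => FU_subset_FU h' (h hs)

theorem FINInf.block_mem (A : FINInf) (i : ℕ) : A.block i ∈ A.blocks := ⟨i, rfl⟩

theorem FINInf.le_of_mem_block (A : FINInf) {i x : ℕ} (hx : x ∈ (A.block i).1) : i ≤ x := by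
  induction i generalizing x with
  | zero => exact Nat.zero_le x
  | succ i ih =>
    obtain ⟨y, hy⟩ := (A.block i).2
    exact (ih hy).trans_lt (precedes_iff.1 (A.precedes_succ i) y hy x hx)

theorem FINInf.lt_of_mem_block (A : FINInf) {i j x y : ℕ} (hij : i < j)
    (hx : x ∈ (A.block i).1) (hy : y ∈ (A.block j).1) : x < y :=
  precedes_iff.1 (A.precedes_of_lt hij) x hx y hy

/-- The sequence `A` without its first `k` blocks. -/
def FINInf.drop (k : ℕ) (A : FINInf) : FINInf where
  block i := A.block (k + i)
  precedes_succ i := A.precedes_succ (k + i)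

theorem FINInf.drop_blocks_subset (k : ℕ) (A : FINInf) : (A.drop k).blocks ⊆ A.blocks := by
  rintro _ ⟨i, rfl⟩
  exact A.block_mem _

theorem FINInf.drop_le (k : ℕ) (A : FINInf) : A.drop k ≤ A :=
  (A.drop_blocks_subset k).trans (subset_FU _)

theorem FINInf.le_of_mem_drop {k : ℕ} {A : FINInf} {s : FIN} (hs : s ∈ FU (A.drop k).blocks)
    {x : ℕ} (hx : x ∈ s.1) : k ≤ x := by
  obtain ⟨_, ⟨i, rfl⟩, hxi, -⟩ := mem_FU.1 hs x hx
  exact (Nat.le_add_right k i).trans (A.le_of_mem_block hxi)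

theorem FINInf.mem_FU_drop {k N : ℕ} {A : FINInf} {s : FIN} (hs : s ∈ FU A.blocks)
    (hN : ∀ i < k, ∀ x ∈ (A.block i).1, x ≤ N) (hsN : ∀ x ∈ s.1, N < x) :
    s ∈ FU (A.drop k).blocks := by
  rw [mem_FU] at *
  intro x hx
  obtain ⟨_, ⟨i, rfl⟩, hxi, his⟩ := hs x hx
  have hki : k ≤ i := by
    by_contra! hlt
    exact absurd (hsN x hx) (not_lt.2 (hN i hlt x hxi))
  refine ⟨_, ⟨i - k, rfl⟩, ?_⟩
  simp only [FINInf.drop, Nat.add_sub_cancel' hki]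
  exact ⟨hxi, his⟩

theorem FINInf.exists_bound (A : FINInf) (k : ℕ) :
    ∃ N, ∀ i < k, ∀ x ∈ (A.block i).1, x ≤ N := by
  refine ⟨(Finset.range k).sup fun i => (A.block i).1.sup id, fun i hi x hx => ?_⟩
  exact (Finset.le_sup (f := id) hx).trans
    (Finset.le_sup (f := fun i => (A.block i).1.sup id) (Finset.mem_range.2 hi))

theorem FINFin.exists_bound (a : FINFin) : ∃ N, ∀ s ∈ a.blocks, ∀ x ∈ s.1, x ≤ N := by
  refine ⟨a.list.toFinset.sup fun s => s.1.sup id, fun s hs x hx => ?_⟩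
  exact (Finset.le_sup (f := id) hx).trans
    (Finset.le_sup (f := fun s : FIN => s.1.sup id) (List.mem_toFinset.2 hs))

/-- The sequence `A` with the finite block sequence `a` put in front. -/
def FINFin.append (a : FINFin) (A : FINInf) (h : ∀ s ∈ a.blocks, Precedes s (A.block 0)) :
    FINInf where
  block i := if hi : i < a.list.length then a.list[i] else A.block (i - a.list.length)
  precedes_succ i := by
    by_cases h1 : i + 1 < a.list.length
    · rw [dif_pos h1, dif_pos (Nat.lt_of_succ_lt h1)]
      exact List.pairwise_iff_getElem.1 a.pairwise _ _ _ _ (Nat.lt_succ_self i)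
    · rw [dif_neg h1]
      by_cases h2 : i < a.list.length
      · rw [dif_pos h2, show i + 1 - a.list.length = 0 by omega]
        exact h _ (List.getElem_mem h2)
      · rw [dif_neg h2, show i + 1 - a.list.length = i - a.list.length + 1 by omega]
        exact A.precedes_succ _

theorem FINFin.append_blocks (a : FINFin) (A : FINInf)
    (h : ∀ s ∈ a.blocks, Precedes s (A.block 0)) :
    (a.append A h).blocks = a.blocks ∪ A.blocks := by
  ext s
  constructor
  · rintro ⟨i, rfl⟩
    by_cases hi : i < a.list.length
    · simp only [FINFin.append, dif_pos hi]
      exact Or.inl (List.getElem_mem hi)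
    · simp only [FINFin.append, dif_neg hi]
      exact Or.inr (A.block_mem _)
  · rintro (hs | ⟨i, rfl⟩)
    · obtain ⟨i, hi, rfl⟩ := List.getElem_of_mem hs
      exact ⟨i, by simp only [FINFin.append, dif_pos hi]⟩
    · exact ⟨a.list.length + i, by simp [FINFin.append]⟩

theorem FINFin.approx_append (a : FINFin) (A : FINInf)
    (h : ∀ s ∈ a.blocks, Precedes s (A.block 0)) :
    a = approx a.length (a.append A h) := by
  ext1
  refine List.ext_getElem ?_ fun i hi _ => ?_
  · simp [approx, FINFin.length]
  · simp [approx, FINFin.append, hi]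

theorem FINFin.append_mem_nbhd {a : FINFin} {A B : FINInf}
    (h : ∀ s ∈ a.blocks, Precedes s (A.block 0)) (ha : a ∈ finBelow B) (hA : A ≤ B) :
    a.append A h ∈ nbhd a B := by
  refine ⟨⟨_, a.approx_append A h⟩, ?_⟩
  rw [FINInf.le_iff, a.append_blocks]
  exact Set.union_subset ha hA

theorem approx_blocks (n : ℕ) (A : FINInf) : (approx n A).blocks = A.block '' Set.Iio n := by
  ext s
  simp [approx, FINFin.blocks]

theorem approx_blocks_subset (n : ℕ) (A : FINInf) : (approx n A).blocks ⊆ A.blocks := by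
  rw [approx_blocks]
  exact Set.image_subset_range _ _

theorem approx_length (n : ℕ) (A : FINInf) : (approx n A).length = n := by
  simp [approx, FINFin.length]

theorem approx_succ_list (n : ℕ) (A : FINInf) :
    (approx (n + 1) A).list = (approx n A).list ++ [A.block n] := by
  simp [approx, List.range_succ]

/-- A tail of `A` starting beyond `a` can always be appended to `a`, so nonemptiness of `[a, A]` is
a condition on the blocks of `a` alone. -/
theorem nbhd_nonempty_iff {a : FINFin} {A : FINInf} : (nbhd a A).Nonempty ↔ a ∈ finBelow A := by
  constructor
  · rintro ⟨B, ⟨n, rfl⟩, hBA⟩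
    exact (approx_blocks_subset n B).trans hBA
  · intro ha
    obtain ⟨N, hN⟩ := a.exists_bound
    refine ⟨a.append (A.drop (N + 1)) fun s hs => precedes_iff.2 fun x hx y hy => ?_,
      FINFin.append_mem_nbhd _ ha (A.drop_le _)⟩
    exact (hN s hs x hx).trans_lt
      (FINInf.le_of_mem_drop (subset_FU _ (FINInf.block_mem _ _)) hy)

theorem block_mem_of_mem_nbhd {a : FINFin} {B C : FINInf} (hC : C ∈ nbhd a B) {i : ℕ}
    (hi : a.length ≤ i) : C.block i ∈ FU B.blocks ∧ ∀ u ∈ a.blocks, Precedes u (C.block i) := by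
  obtain ⟨⟨n, rfl⟩, hCB⟩ := hC
  refine ⟨hCB (C.block_mem i), fun u hu => ?_⟩
  rw [approx_blocks] at hu
  obtain ⟨j, hj, rfl⟩ := hu
  rw [approx_length] at hi
  exact C.precedes_of_lt (lt_of_lt_of_le hj hi)

theorem blocks_subset_of_mem_nbhd {a : FINFin} {B C : FINInf} (hC : C ∈ nbhd a B) :
    C.blocks ⊆ a.blocks ∪ {t | t ∈ FU B.blocks ∧ ∀ u ∈ a.blocks, Precedes u t} := by
  rintro _ ⟨i, rfl⟩
  by_cases hi : a.length ≤ i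
  · exact Or.inr (block_mem_of_mem_nbhd hC hi)
  · obtain ⟨⟨n, rfl⟩, -⟩ := hC
    left
    rw [approx_blocks]
    rw [approx_length] at hi
    exact ⟨i, not_le.1 hi, rfl⟩

/-! ### Depth -/

theorem LEFin_approx_of_bound {A : FINInf} {a : FINFin} (ha : a ∈ finBelow A) {N : ℕ}
    (hN : ∀ s ∈ a.blocks, ∀ x ∈ s.1, x < N) : LEFin a (approx N A) := by
  intro s hs
  rw [mem_FU]
  intro x hx
  obtain ⟨_, ⟨i, rfl⟩, hxi, his⟩ := mem_FU.1 (ha hs) x hx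
  refine ⟨_, ?_, hxi, his⟩
  rw [approx_blocks]
  exact ⟨i, (A.le_of_mem_block hxi).trans_lt (hN s hs x hx), rfl⟩

/-- The elements of the `i`-th block of `A` are at least `i`, so a sequence bounded by `N` meets
only the first `N` blocks. -/
theorem depth_le_of_bound {A : FINInf} {a : FINFin} (ha : a ∈ finBelow A) {N : ℕ}
    (hN : ∀ s ∈ a.blocks, ∀ x ∈ s.1, x < N) : depth A a ≤ N :=
  Nat.sInf_le (LEFin_approx_of_bound ha hN)

theorem LEFin_approx_depth {A : FINInf} {a : FINFin} (ha : a ∈ finBelow A) :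
    LEFin a (approx (depth A a) A) := by
  obtain ⟨N, hN⟩ := a.exists_bound
  exact Nat.sInf_mem (s := {n | LEFin a (approx n A)})
    ⟨N + 1, LEFin_approx_of_bound ha fun s hs x hx => Nat.lt_succ_of_le (hN s hs x hx)⟩

/-- A finite union of blocks of `r_d(A) ⌢ B`, `d = depth_A(a)`, that lies after `a` uses only
blocks of `B`. -/
theorem mem_FU_of_after_depth {A B : FINInf} {a : FINFin} (ha : a ∈ finBelow A) {t : FIN}
    (ht : t ∈ FU ((approx (depth A a) A).blocks ∪ B.blocks))
    (hat : ∀ u ∈ a.blocks, Precedes u t) : t ∈ FU B.blocks := by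
  rw [mem_FU] at ht ⊢
  intro x hx
  obtain ⟨s, hs | hs, hxs, hst⟩ := ht x hx
  · exfalso
    rw [approx_blocks] at hs
    obtain ⟨i, hi, rfl⟩ := hs
    -- If `t` used block `i < d`, then `a`, lying before `t`, could use only blocks of index below
    -- `i`, so its depth would be at most `i`.
    refine Nat.notMem_of_lt_sInf hi fun u hu => mem_FU.2 fun y hy => ?_
    obtain ⟨_, ⟨j, rfl⟩, hyj, hju⟩ := mem_FU.1 (ha hu) y hy
    refine ⟨_, ?_, hyj, hju⟩
    rw [approx_blocks]
    refine ⟨j, ?_, rfl⟩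
    rw [Set.mem_Iio]
    by_contra! hij
    rcases hij.lt_or_eq with h | rfl
    · exact lt_asymm (A.lt_of_mem_block h hxs hyj) (precedes_iff.1 (hat u hu) y hy x hx)
    · exact lt_irrefl _ (precedes_iff.1 (hat u hu) x (hju hxs) x hx)
  · exact ⟨s, hs, hxs, hst⟩

/-! ### Finite changes -/

theorem ClosedUnderFiniteChanges.drop_mem {H : Set FINInf} (hH : ClosedUnderFiniteChanges H)
    {A : FINInf} (hA : A ∈ H) (k : ℕ) : A.drop k ∈ H := by
  refine hH A _ hA (((Set.finite_Iio k).image A.block).subset ?_)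
  rintro s (⟨⟨i, rfl⟩, hs⟩ | ⟨hs, hs'⟩)
  · refine ⟨i, ?_, rfl⟩
    by_contra hi
    refine hs ⟨i - k, ?_⟩
    simp only [FINInf.drop, Nat.add_sub_cancel' (not_lt.1 hi)]
  · exact absurd (A.drop_blocks_subset k hs) hs'

theorem ClosedUnderFiniteChanges.append_mem {H : Set FINInf} (hH : ClosedUnderFiniteChanges H)
    {A : FINInf} (hA : A ∈ H) (a : FINFin) (h : ∀ s ∈ a.blocks, Precedes s (A.block 0)) :
    a.append A h ∈ H := by
  refine hH A _ hA (a.list.finite_toSet.subset ?_)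
  rw [a.append_blocks]
  rintro s (⟨hs, hs'⟩ | ⟨hs | hs, hs'⟩)
  · exact absurd (Or.inr hs) hs'
  · exact hs
  · exact absurd hs hs'

/-! ### Short gaps -/

/-- The number of elements `x` of `s` whose successor in `s` is at most `F x`. -/
def shortGaps (F : ℕ → ℕ) (s : Finset ℕ) : ℕ := (s.filter fun x => ∃ y ∈ s, x < y ∧ y ≤ F x).card

/-- Only `max s` gains a successor in the union, namely `min t`; every other element keeps the one
it had. -/
theorem shortGaps_union (F : ℕ → ℕ) {s t : FIN} (h : Precedes s t) :
    shortGaps F (s.1 ∪ t.1) = shortGaps F s.1 + shortGaps F t.1 +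
      if t.1.min' t.2 ≤ F (s.1.max' s.2) then 1 else 0 := by
  have hst := precedes_iff.1 h
  have hms := s.1.max'_mem s.2
  have hmt := t.1.min'_mem t.2
  set m := s.1.max' s.2 with hm
  set l := t.1.min' t.2 with hl
  have hsm : ∀ x ∈ s.1, x ≤ m := fun x hx => s.1.le_max' x hx
  have htl : ∀ x ∈ t.1, l ≤ x := fun x hx => t.1.min'_le x hx
  have key : (s.1 ∪ t.1).filter (fun x => ∃ y ∈ s.1 ∪ t.1, x < y ∧ y ≤ F x) =
      (s.1.filter (fun x => ∃ y ∈ s.1, x < y ∧ y ≤ F x) ∪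
        t.1.filter (fun x => ∃ y ∈ t.1, x < y ∧ y ≤ F x)) ∪
        (if l ≤ F m then {m} else ∅) := by
    ext x
    simp only [Finset.mem_union, Finset.mem_filter]
    constructor
    · rintro ⟨hx | hx, y, hy | hy, hxy, hyF⟩
      · exact Or.inl (Or.inl ⟨hx, y, hy, hxy, hyF⟩)
      · rcases (hsm x hx).lt_or_eq with hlt | rfl
        · exact Or.inl (Or.inl ⟨hx, m, hms, hlt, (hst m hms y hy).le.trans hyF⟩)
        · right
          rw [if_pos ((htl y hy).trans hyF)]
          exact Finset.mem_singleton_self _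
      · exact absurd (hst y hy x hx) (not_lt.2 hxy.le)
      · exact Or.inl (Or.inr ⟨hx, y, hy, hxy, hyF⟩)
    · rintro ((⟨hx, y, hy, hxy⟩ | ⟨hx, y, hy, hxy⟩) | hx)
      · exact ⟨Or.inl hx, y, Or.inl hy, hxy⟩
      · exact ⟨Or.inr hx, y, Or.inr hy, hxy⟩
      · split_ifs at hx with hF
        · rw [Finset.mem_singleton] at hx
          subst hx
          exact ⟨Or.inl hms, l, Or.inr hmt, hst _ hms _ hmt, hF⟩
        · exact absurd hx (Finset.notMem_empty x)
  unfold shortGaps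
  rw [key, Finset.card_union_of_disjoint, Finset.card_union_of_disjoint]
  · congr 1
    split_ifs <;> simp
  · rw [Finset.disjoint_left]
    intro x hx hx'
    exact lt_irrefl x (hst x (Finset.mem_filter.1 hx).1 x (Finset.mem_filter.1 hx').1)
  · rw [Finset.disjoint_right]
    intro x hx hx'
    split_ifs at hx
    · rw [Finset.mem_singleton] at hx
      subst hx
      rcases Finset.mem_union.1 hx' with hx' | hx'
      · obtain ⟨-, y, hy, hlt, -⟩ := Finset.mem_filter.1 hx'
        exact absurd (hsm y hy) (not_le.2 hlt)
      · exact lt_irrefl _ (hst _ hms _ (Finset.mem_filter.1 hx').1)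
    · exact absurd hx (Finset.notMem_empty x)

/-- If the parity of the number of short gaps is constant on `FU(B)`, then there are no short
gaps between the blocks of `B`. -/
theorem lt_of_shortGaps_parity {F : ℕ → ℕ} {B : FINInf} {c : ℕ}
    (hc : ∀ t ∈ FU B.blocks, shortGaps F t.1 % 2 = c) {i j : ℕ} (hij : i < j) :
    F ((B.block i).1.max' (B.block i).2) < (B.block j).1.min' (B.block j).2 := by
  have key : ∀ i j, i < j → (c + c +
      if (B.block j).1.min' (B.block j).2 ≤ F ((B.block i).1.max' (B.block i).2)
        then 1 else 0) % 2 = c := by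
    intro i j hij
    have hi := hc _ (subset_FU _ (B.block_mem i))
    have hj := hc _ (subset_FU _ (B.block_mem j))
    have hu := hc ⟨(B.block i).1 ∪ (B.block j).1, (B.block i).2.mono Finset.subset_union_left⟩
      (union_mem_FU (subset_FU _ (B.block_mem i)) (subset_FU _ (B.block_mem j)) rfl)
    rw [shortGaps_union F (B.precedes_of_lt hij)] at hu
    omega
  by_contra! hle
  have h1 := key i j hij
  rw [if_pos hle] at h1
  set m := F ((B.block i).1.max' (B.block i).2) with hm
  -- Block `i + m + 1` starts above `m`, so its gap after block `i` is not short and `c` is even;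
  -- the assumed short gap made `c` odd.
  have h2 := key i (i + m + 1) (by omega)
  rw [if_neg] at h2
  · omega
  · rw [← hm]
    have := B.le_of_mem_block ((B.block (i + m + 1)).1.min'_mem (B.block (i + m + 1)).2)
    omega

/-! ### Matet-adequate families are selective coideals -/

theorem IsMatetAdequate.exists_sparse {H : Set FINInf} (hH : IsMatetAdequate H) {A : FINInf}
    (hA : A ∈ H) (F : ℕ → ℕ) : ∃ B ∈ H, B ≤ A ∧ ∀ i j, i < j →
      F ((B.block i).1.max' (B.block i).2) < (B.block j).1.min' (B.block j).2 := by
  obtain ⟨B, hB, hBA, hBP⟩ := hH.hindman A hA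
    {t | t ∈ FU A.blocks ∧ shortGaps F t.1 % 2 = 0}
    {t | t ∈ FU A.blocks ∧ shortGaps F t.1 % 2 = 1}
    (by
      ext t
      have := Nat.mod_two_eq_zero_or_one (shortGaps F t.1)
      simp only [Set.mem_union, Set.mem_ofPred_eq]
      tauto)
    (by
      rw [Set.disjoint_left]
      rintro t ⟨-, h⟩ ⟨-, h'⟩
      omega)
  refine ⟨B, hB, hBA, fun i j hij => ?_⟩
  rcases hBP with h | h
  · exact lt_of_shortGaps_parity (fun t ht => (h ht).2) hij
  · exact lt_of_shortGaps_parity (fun t ht => (h ht).2) hij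

theorem AlmostLE.exists_bound {A B : FINInf} (h : AlmostLE A B) :
    ∃ N, ∀ s ∈ FU A.blocks, (∀ x ∈ s.1, N < x) → s ∈ FU B.blocks := by
  refine ⟨h.toFinset.sup fun s => s.1.sup id, fun s hs hN => mem_FU.2 fun x hx => ?_⟩
  obtain ⟨u, hu, hxu, hus⟩ := mem_FU.1 hs x hx
  have huB : u ∈ FU B.blocks := by
    by_contra hn
    refine absurd (hN x hx) (not_lt.2 ?_)
    exact (Finset.le_sup (f := id) hxu).trans
      (Finset.le_sup (f := fun s : FIN => s.1.sup id) (h.mem_toFinset.2 ⟨hu, hn⟩))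
  obtain ⟨v, hv, hxv, hvu⟩ := mem_FU.1 huB x hxu
  exact ⟨v, hv, hxv, hvu.trans hus⟩

theorem FINInf.AlmostLE_of_le {A B : FINInf} (h : A ≤ B) : AlmostLE A B := by
  unfold AlmostLE
  rw [Set.sdiff_eq_empty.2 h]
  exact Set.finite_empty

theorem FU_antitone_of_succ_le {𝒜 : ℕ → FINInf} (h : ∀ n, 𝒜 (n + 1) ≤ 𝒜 n) :
    Antitone fun n => FU (𝒜 n).blocks :=
  antitone_nat_of_succ_le fun n => FU_subset_FU (h n)

theorem IsMatetAdequate.isCoideal {H : Set FINInf} (hH : IsMatetAdequate H) : IsCoideal H where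
  finite_changes := hH.finite_changes
  upwards := hH.upwards
  amalgamation_nonempty := by
    rintro A - a ha B ⟨⟨⟨n, hn⟩, -⟩, -⟩
    rw [nbhd_nonempty_iff]
    refine (LEFin_approx_depth ha).trans (FU_subset_FU ?_)
    rw [hn]
    exact (approx_blocks_subset n B).trans (subset_FU _)
  amalgamation_subset := by
    intro A _ a ha B hB hBA hne
    -- The witness is `r_d(A)` followed by a tail of `B` starting beyond it.
    obtain ⟨N, hN⟩ := (approx (depth A a) A).exists_bound
    have hprec : ∀ s ∈ (approx (depth A a) A).blocks,
        Precedes s ((B.drop (N + 1)).block 0) := fun s hs => precedes_iff.2 fun x hx y hy =>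
      (hN s hs x hx).trans_lt (FINInf.le_of_mem_drop (subset_FU _ (FINInf.block_mem _ _)) hy)
    refine ⟨(approx (depth A a) A).append (B.drop (N + 1)) hprec, ⟨?_, ?_⟩, ?_, ?_⟩
    · exact FINFin.append_mem_nbhd _ ((approx_blocks_subset _ _).trans (subset_FU _))
        (FINInf.le_trans (B.drop_le _) hBA)
    · exact hH.finite_changes.append_mem (hH.finite_changes.drop_mem hB _) _ _
    · rw [nbhd_nonempty_iff]
      refine (LEFin_approx_depth ha).trans (FU_subset_FU ?_)
      rw [FINFin.append_blocks]
      exact Set.subset_union_left.trans (subset_FU _)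
    · intro C hC
      refine ⟨hC.1, fun s hs => ?_⟩
      rcases blocks_subset_of_mem_nbhd hC hs with hs | ⟨hs, has⟩
      · exact nbhd_nonempty_iff.1 hne hs
      · rw [FINFin.append_blocks] at hs
        exact FU_subset_FU (B.drop_le _) (mem_FU_of_after_depth ha hs has)
  pigeonhole := by
    intro A hA a ha O _
    -- Color `t` by whether `a` extended by `t` is in `O`, working past `r_d(A)` so that the result
    -- can be appended to it.
    obtain ⟨B, hB, hBA, hBP⟩ := hH.hindman (A.drop (depth A a)) (hH.finite_changes.drop_mem hA _)
      {t | t ∈ FU (A.drop (depth A a)).blocks ∧ ∃ o ∈ O, o.list = a.list ++ [t]}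
      {t | t ∈ FU (A.drop (depth A a)).blocks ∧ ¬ ∃ o ∈ O, o.list = a.list ++ [t]}
      (by
        ext t
        simp only [Set.mem_union, Set.mem_ofPred_eq, ← and_or_left, Classical.em, and_true])
      (by
        rw [Set.disjoint_left]
        rintro t ⟨-, h⟩ ⟨-, h'⟩
        exact h' h)
    have hprec : ∀ s ∈ (approx (depth A a) A).blocks, Precedes s (B.block 0) := by
      intro s hs
      rw [approx_blocks] at hs
      obtain ⟨i, hi, rfl⟩ := hs
      refine precedes_iff.2 fun x hx y hy => ?_
      obtain ⟨_, ⟨j, rfl⟩, hyj, -⟩ := mem_FU.1 (hBA (B.block_mem 0)) y hy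
      exact A.lt_of_mem_block (Nat.lt_add_right j hi) hx hyj
    have hnext : ∀ C ∈ nbhd a ((approx (depth A a) A).append B hprec),
        C.block a.length ∈ FU B.blocks ∧
          (approx (a.length + 1) C).list = a.list ++ [C.block a.length] := by
      intro C hC
      obtain ⟨h1, h2⟩ := block_mem_of_mem_nbhd hC le_rfl
      rw [FINFin.append_blocks] at h1
      refine ⟨mem_FU_of_after_depth ha h1 h2, ?_⟩
      obtain ⟨⟨n, rfl⟩, -⟩ := hC
      rw [approx_length, approx_succ_list]
    refine ⟨(approx (depth A a) A).append B hprec, ⟨?_, ?_⟩, ?_⟩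
    · exact FINFin.append_mem_nbhd _ ((approx_blocks_subset _ _).trans (subset_FU _))
        (FINInf.le_trans hBA (A.drop_le _))
    · exact hH.finite_changes.append_mem hB _ _
    · refine hBP.imp (fun h => ?_) fun h => ?_
      · rintro _ ⟨C, hC, rfl⟩
        obtain ⟨h1, h2⟩ := hnext C hC
        obtain ⟨-, o, ho, hol⟩ := h h1
        rwa [FINFin.ext (h2.trans hol.symm)]
      · rw [Set.eq_empty_iff_forall_notMem]
        rintro _ ⟨⟨C, hC, rfl⟩, hO⟩
        obtain ⟨h1, h2⟩ := hnext C hC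
        exact (h h1).2 ⟨_, hO, h2⟩

theorem IsMatetAdequate.exists_diagonalizes {H : Set FINInf} (hH : IsMatetAdequate H)
    {a : FINFin} {A : FINInf} (haA : a ∈ finBelow A) {𝒜 : ℕ → FINInf}
    (h𝒜 : ∀ n, 𝒜 n ∈ H ∧ 𝒜 n ≤ A) (hanti : ∀ n, 𝒜 (n + 1) ≤ 𝒜 n)
    (ha : ∀ n, a ∈ finBelow (𝒜 n)) : ∃ B ∈ H ∩ nbhd a A, Diagonalizes B 𝒜 A := by
  have hmono := FU_antitone_of_succ_le hanti
  obtain ⟨C, hC, hC𝒜⟩ := hH.sigma_closed 𝒜 (fun n => (h𝒜 n).1)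
    fun n => FINInf.AlmostLE_of_le (hanti n)
  choose f hf using fun n => (hC𝒜 n).exists_bound
  -- The shift to `k + 1` is there because a sequence with elements at most `x` has depth at most `x
  -- + 1`; the supremum makes `F` monotone.
  let F : ℕ → ℕ := fun x => (Finset.range (x + 1)).sup fun k => f (k + 1)
  have hFmono : Monotone F := fun x y hxy =>
    Finset.sup_mono (Finset.range_mono (Nat.succ_le_succ hxy))
  have hfF : ∀ x, f (x + 1) ≤ F x := fun x =>
    Finset.le_sup (f := fun k => f (k + 1)) (Finset.self_mem_range_succ x)
  obtain ⟨D, hD, hDC, hDgap⟩ := hH.exists_sparse hC F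
  obtain ⟨N, hN⟩ := a.exists_bound
  -- Past `N` the tail can follow `a`; past `F N` its blocks lie in every term of index `x + 1` with
  -- `x ≤ N`.
  set k := max (N + 1) (F N + 1) with hk
  have hlow : ∀ i, ∀ x ∈ ((D.drop k).block i).1, N < x ∧ F N < x := by
    intro i x hx
    have := FINInf.le_of_mem_drop (subset_FU _ (FINInf.block_mem _ _)) hx
    omega
  have hprec : ∀ s ∈ a.blocks, Precedes s ((D.drop k).block 0) := fun s hs =>
    precedes_iff.2 fun x hx y hy => (hN s hs x hx).trans_lt (hlow 0 y hy).1
  have hmem : ∀ i x, (∀ y ∈ ((D.drop k).block i).1, F x < y) →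
      (D.drop k).block i ∈ FU (𝒜 (x + 1)).blocks := fun i x h =>
    hf (x + 1) _ (hDC (D.block_mem _)) fun y hy => (hfF x).trans_lt (h y hy)
  have hmemN : ∀ i, ∀ x ≤ N, (D.drop k).block i ∈ FU (𝒜 (x + 1)).blocks := fun i x hx =>
    hmem i x fun y hy => (hFmono hx).trans_lt (hlow i y hy).2
  refine ⟨a.append (D.drop k) hprec, ⟨?_, ?_⟩, ?_⟩
  · exact hH.finite_changes.append_mem (hH.finite_changes.drop_mem hD _) _ _
  · refine FINFin.append_mem_nbhd _ haA ?_
    rintro _ ⟨i, rfl⟩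
    exact FU_subset_FU (h𝒜 _).2 (hmemN i 0 (Nat.zero_le N))
  · rintro b hbB hbA s ⟨hs, hbs⟩
    rw [FINFin.append_blocks] at hs
    rcases hs with hs | ⟨i, rfl⟩
    · exact ha _ hs
    have hx : ∃ x, depth A b ≤ x + 1 ∧ (D.drop k).block i ∈ FU (𝒜 (x + 1)).blocks := by
      -- If `b` exceeds `N`, its elements above `N` come from tail blocks before the `i`-th, so `b`
      -- is bounded by `m`, the maximum of block `i - 1`. The gap after `m` then puts block `i` in
      -- term `m + 1`.
      by_cases hbN : ∀ u ∈ b.blocks, ∀ x ∈ u.1, x ≤ N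
      · exact ⟨N, depth_le_of_bound hbA fun u hu x hx => Nat.lt_succ_of_le (hbN u hu x hx),
          hmemN i N le_rfl⟩
      push Not at hbN
      have hi : ∀ u ∈ b.blocks, ∀ x ∈ u.1, N < x →
          ∃ j < i, x ∈ ((D.drop k).block j).1 := by
        intro u hu x hx hNx
        obtain ⟨v, hv, hxv, -⟩ := mem_FU.1 (hbB hu) x hx
        rw [FINFin.append_blocks] at hv
        rcases hv with hv | ⟨j, rfl⟩
        · exact absurd (hN v hv x hxv) (not_le.2 hNx)
        refine ⟨j, ?_, hxv⟩
        by_contra hij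
        obtain ⟨y, hy⟩ := ((D.drop k).block i).2
        have hxy := precedes_iff.1 (hbs u hu) x hx
        rcases (not_lt.1 hij).lt_or_eq with h | rfl
        · exact lt_asymm (hxy y hy) ((D.drop k).lt_of_mem_block h hy hxv)
        · exact lt_irrefl _ (hxy x hxv)
      obtain ⟨u, hu, x, hx, hNx⟩ := hbN
      obtain ⟨j, hj, -⟩ := hi u hu x hx hNx
      have hi0 : i - 1 < i := by omega
      set m := ((D.drop k).block (i - 1)).1.max' ((D.drop k).block (i - 1)).2 with hm
      have hmm : m ∈ ((D.drop k).block (i - 1)).1 := Finset.max'_mem _ _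
      refine ⟨m, depth_le_of_bound hbA fun u hu x hx => ?_, hmem i m fun y hy => ?_⟩
      · rw [Nat.lt_succ_iff]
        rcases le_or_gt x N with h | h
        · exact h.trans (hlow _ m hmm).1.le
        · obtain ⟨j, hj, hxj⟩ := hi u hu x hx h
          rcases (Nat.le_sub_one_of_lt hj).lt_or_eq with h' | rfl
          · exact ((D.drop k).lt_of_mem_block h' hxj hmm).le
          · exact Finset.le_max' _ _ hxj
      · exact (hDgap (k + (i - 1)) (k + i) (by omega)).trans_le (Finset.min'_le _ _ hy)
    obtain ⟨x, hx, hsx⟩ := hx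
    exact hmono hx hsx

theorem IsMatetAdequate.isSelectiveCoideal {H : Set FINInf} (hH : IsMatetAdequate H) :
    IsSelectiveCoideal H where
  toIsCoideal := hH.isCoideal
  selective _ _ _ haA _ h𝒜 hanti ha :=
    hH.exists_diagonalizes (nbhd_nonempty_iff.1 haA) h𝒜 hanti fun n => nbhd_nonempty_iff.1 (ha n)

/-! ### Selective coideals are Matet-adequate -/

/-- The empty block sequence. -/
def FINFin.empty : FINFin := ⟨[], List.Pairwise.nil⟩

/-- The block sequence with the single block `s`. -/
def FINFin.single (s : FIN) : FINFin := ⟨[s], List.pairwise_singleton _ _⟩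

theorem FINFin.empty_mem_finBelow (A : FINInf) : FINFin.empty ∈ finBelow A :=
  fun _ hs => absurd hs List.not_mem_nil

theorem FINFin.single_mem_finBelow {A : FINInf} {s : FIN} (hs : s ∈ FU A.blocks) :
    FINFin.single s ∈ finBelow A := by
  intro t ht
  rwa [List.mem_singleton.1 ht]

theorem exists_approx_one {B : FINInf} {t : FIN} (ht : t ∈ FU B.blocks) :
    FINFin.single t ∈ approx 1 '' nbhd FINFin.empty B := by
  obtain ⟨C, ⟨n, hn⟩, hCB⟩ := nbhd_nonempty_iff.2 (FINFin.single_mem_finBelow ht)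
  refine ⟨C, ⟨⟨0, rfl⟩, hCB⟩, ?_⟩
  have := approx_length n C
  rw [← hn] at this
  rw [hn, ← this]
  rfl

theorem IsCoideal.hindman {H : Set FINInf} (hH : IsCoideal H) {A : FINInf} (hA : A ∈ H)
    {P Q : Set FIN} (hPQ : P ∪ Q = FU A.blocks) :
    ∃ B ∈ H, B ≤ A ∧ (FU B.blocks ⊆ P ∨ FU B.blocks ⊆ Q) := by
  obtain ⟨B, ⟨⟨-, hBA⟩, hB⟩, h⟩ := hH.pigeonhole A hA FINFin.empty
    (FINFin.empty_mem_finBelow A) (FINFin.single '' P) (by rintro _ ⟨s, -, rfl⟩; rfl)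
  have hsingle : ∀ t, FINFin.single t ∈ FINFin.single '' P → t ∈ P := by
    rintro t ⟨s, hs, hst⟩
    obtain rfl : s = t := by simpa [FINFin.single] using hst
    exact hs
  refine ⟨B, hB, hBA, h.imp (fun h t ht => hsingle t (h (exists_approx_one ht))) fun h t ht => ?_⟩
  have htA : t ∈ P ∪ Q := hPQ ▸ FU_subset_FU hBA ht
  refine htA.resolve_left fun htP => ?_
  exact Set.eq_empty_iff_forall_notMem.1 h _ ⟨exists_approx_one ht, t, htP, rfl⟩

/-- Selectivity requires a genuinely decreasing sequence. Each cut is chosen from the previous one,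
beyond both the exceptional blocks and the blocks already cut. -/
theorem exists_drop_le {𝒜 : ℕ → FINInf} (h : ∀ n, AlmostLE (𝒜 (n + 1)) (𝒜 n)) :
    ∃ k : ℕ → ℕ, ∀ n, (𝒜 (n + 1)).drop (k (n + 1)) ≤ (𝒜 n).drop (k n) := by
  have step : ∀ n k, ∃ l, (𝒜 (n + 1)).drop l ≤ (𝒜 n).drop k := by
    intro n k
    obtain ⟨N, hN⟩ := (h n).exists_bound
    obtain ⟨M, hM⟩ := (𝒜 n).exists_bound k
    refine ⟨max N M + 1, fun s hs => ?_⟩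
    have hs' := subset_FU _ hs
    have hlow : ∀ x ∈ s.1, max N M < x := fun x hx => FINInf.le_of_mem_drop hs' hx
    exact FINInf.mem_FU_drop
      (hN s (FU_subset_FU (FINInf.drop_le _ _) hs') fun x hx =>
        (le_max_left N M).trans_lt (hlow x hx))
      hM fun x hx => (le_max_right N M).trans_lt (hlow x hx)
  choose g hg using step
  exact ⟨fun n => Nat.rec 0 g n, fun n => hg n _⟩

/-- A block of `B` lying beyond the first `n` blocks of `A` cannot be built from them. -/
theorem exists_le_depth_single {A B : FINInf} (hBA : B ≤ A) (n : ℕ) :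
    ∃ m, n ≤ depth A (FINFin.single (B.block m)) := by
  obtain ⟨N, hN⟩ := A.exists_bound n
  refine ⟨N + 1, ?_⟩
  by_contra! hlt
  have hle := LEFin_approx_depth (FINFin.single_mem_finBelow (hBA (B.block_mem (N + 1))))
    (List.mem_singleton_self _)
  obtain ⟨x, hx⟩ := (B.block (N + 1)).2
  obtain ⟨s, hs, hxs, -⟩ := mem_FU.1 hle x hx
  rw [approx_blocks] at hs
  obtain ⟨i, hi, rfl⟩ := hs
  exact absurd (B.le_of_mem_block hx) (not_le.2 (Nat.lt_succ_of_le (hN i (lt_trans hi hlt) x hxs)))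

theorem Diagonalizes.almostLE {A B : FINInf} {𝒜 : ℕ → FINInf} (h : Diagonalizes B 𝒜 A)
    (hBA : B ≤ A) (hanti : ∀ n, 𝒜 (n + 1) ≤ 𝒜 n) (n : ℕ) : AlmostLE B (𝒜 n) := by
  obtain ⟨m, hm⟩ := exists_le_depth_single hBA n
  refine ((Set.finite_Iic m).image B.block).subset ?_
  rintro _ ⟨⟨i, rfl⟩, hi⟩
  refine ⟨i, ?_, rfl⟩
  by_contra him
  refine hi (FU_antitone_of_succ_le hanti hm (h _
    (FINFin.single_mem_finBelow (subset_FU _ (B.block_mem m)))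
    (FINFin.single_mem_finBelow (hBA (B.block_mem m))) ⟨B.block_mem i, fun t ht => ?_⟩))
  rw [List.mem_singleton.1 ht]
  exact B.precedes_of_lt (not_le.1 him)

theorem IsSelectiveCoideal.isMatetAdequate {H : Set FINInf} (hH : IsSelectiveCoideal H) :
    IsMatetAdequate H where
  finite_changes := hH.finite_changes
  upwards := hH.upwards
  sigma_closed := by
    intro 𝒜 h𝒜 hle
    obtain ⟨k, hk⟩ := exists_drop_le hle
    have hanti := FU_antitone_of_succ_le (𝒜 := fun n => (𝒜 n).drop (k n)) hk
    obtain ⟨B, ⟨hB, -, hBA⟩, hdiag⟩ := hH.selective FINFin.empty (𝒜 0) (h𝒜 0)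
      (nbhd_nonempty_iff.2 (FINFin.empty_mem_finBelow _)) (fun n => (𝒜 n).drop (k n))
      (fun n => ⟨hH.finite_changes.drop_mem (h𝒜 n) _, fun s hs =>
        FU_subset_FU (FINInf.drop_le _ _) (hanti (Nat.zero_le n) (subset_FU _ hs))⟩)
      hk fun n => nbhd_nonempty_iff.2 (FINFin.empty_mem_finBelow _)
    refine ⟨B, hB, fun n => (hdiag.almostLE hBA hk n).subset ?_⟩
    exact Set.sdiff_subset_sdiff_right (FU_subset_FU (FINInf.drop_le _ _))
  hindman _ hA _ _ hPQ _ := hH.toIsCoideal.hindman hA hPQ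

end BlockSeq

theorem mainTheorem3 (H : Set BlockSeq.FINInf) :
    BlockSeq.IsMatetAdequate H ↔ BlockSeq.IsSelectiveCoideal H :=
  ⟨fun h => h.isSelectiveCoideal, fun h => h.isMatetAdequate⟩
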